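/- \textbf{Definitions.} For an integer $s\ge 1$, a \emph{Davenport--Schinzel sequence of order $s$} is a finite sequence with no two adjacent equal symbols that contains no (not necessarily contiguous) alternation $a\ldots b\ldots a\ldots b\ldots$ of length $s+2$ with $a\ne b$. For positive integers $s,m,n$, let $\psi_s(m,n)$ be the maximum length of a Davenport--Schinzel sequence of order $s$ on $n$ distinct symbols that can be partitioned into $m$ or fewer contiguous blocks, each block consisting of distinct symbols. Let $A_1(n)=2n$ and $A_k(n)=A_{k-1}^{(n)}(1)$ (the $n$-fold composition of $A_{k-1}$, applied to $1$) for $k\ge 2$, and let $\alpha_k(x)=\min\{n\ge 0 : A_k(n)\ge x\}$ for $k\ge 1$ and real $x\ge 0$. \textbf{Lemma.} For $s=3$ there is an absolute constant $c$ such that $$\psi_3(m,n)\le c\,\bigl(k\,m\,\alpha_k(m)+k\,n\bigr)\qquad\text{for all integers } k,m,n\ge 1.$$ In general, for every fixed $s\ge 3$, with $t=\lfloor (s-2)/2\rfloor$, there are constants $C_{s,k}$ ($k\ge 1$) such that $$\psi_s(m,n)\le C_{s,k}\bigl(m\,\alpha_k(m)^{s-2}+n\bigr)\qquad\text{for all integers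 } k,m,n\ge 1,$$ and these constants are of the form $$C_{s,k}=\begin{cases}2^{(1/t!)k^t\pm O(k^{t-1})}, & s \text{ even};\\ 2^{(1/t!)k^t\log_2 k\pm O(k^t)}, & s\text{ odd},\end{cases}$$ where the constants implicit in the $O$ notation depend only on $s$. -/

import Mathlib

namespace DS

/-- `u ⊂ S`: some (not necessarily contiguous) subsequence of `S` is obtained from `u` by a
one-to-one renaming of the symbols of `u`. -/
def Contains {α β : Type*} (u : List α) (S : List β) : Prop :=
  ∃ f : α → β, Set.InjOn f {a | a ∈ u} ∧ (u.map f).Sublist S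

/-- The sequence `a b a b a ...` of length `l`, with `a = 0` and `b = 1`. -/
def alternation (l : ℕ) : List ℕ := (List.range l).map (fun i => i % 2)

/-- `S` is a Davenport--Schinzel sequence of order `s`: no two adjacent symbols are equal, and
`S` contains no alternation `a ... b ... a ... b ...` of length `s + 2`. -/
def IsDS {α : Type*} (s : ℕ) (S : List α) : Prop :=
  S.IsChain (fun a b => a ≠ b) ∧ ¬ Contains (alternation (s + 2)) S

/-- `S` can be partitioned into `m` or fewer contiguous blocks, each of distinct symbols. -/
def HasBlocks {α : Type*} (m : ℕ) (S : List α) : Prop :=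
  ∃ L : List (List α), L.length ≤ m ∧ L.flatten = S ∧ ∀ B ∈ L, B.Nodup

/-- The possible lengths of Davenport--Schinzel sequences of order `s` on `n` distinct symbols
that can be partitioned into `m` or fewer blocks of distinct symbols. (Symbols are taken to be
natural numbers, which loses no generality.) -/
def psiLengths (s m n : ℕ) : Set ℕ :=
  {l | ∃ S : List ℕ, IsDS s S ∧ S.toFinset.card = n ∧ HasBlocks m S ∧ S.length = l}

/-- `ψ_s(m, n)`, the maximum of `psiLengths s m n`, for positive `s`, `m`, `n`; the maximum
exists by `psi_isGreatest`. -/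
noncomputable def psi (s m n : ℕ) : ℕ := sSup (psiLengths s m n)

/-- The Ackermann hierarchy: `A_1(n) = 2n` and `A_k(n) = A_{k-1}^{(n)}(1)` for `k ≥ 2`.
The hierarchy starts at `k = 1`; the value at `k = 0` is a placeholder. -/
def ackA : ℕ → ℕ → ℕ
  | 0 => fun n => n
  | 1 => fun n => 2 * n
  | k + 2 => fun n => (ackA (k + 1))^[n] 1

/-- The inverse Ackermann hierarchy, `α_k(x) = min {n | A_k(n) ≥ x}`, for `k ≥ 1`; the minimum
exists by `alphaInv_nonempty`. -/
noncomputable def alphaInv (k : ℕ) (x : ℝ) : ℕ := sInf {n : ℕ | x ≤ (ackA k n : ℝ)}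

theorem psiLengths_le {s m n l : ℕ} (h : l ∈ psiLengths s m n) : l ≤ m * n := by
  obtain ⟨S, -, hn, ⟨L, hm, rfl, hL⟩, rfl⟩ := h
  have key : ∀ B ∈ L, B.length ≤ n := by
    intro B hB
    rw [← hn, ← List.toFinset_card_of_nodup (hL B hB)]
    apply Finset.card_le_card
    intro a ha
    rw [List.mem_toFinset] at ha ⊢
    exact List.mem_flatten.2 ⟨B, hB, ha⟩
  rw [List.length_flatten]
  calc (L.map List.length).sum ≤ (L.map List.length).length • n := by
        apply List.sum_le_card_nsmul
        intro x hx
        obtain ⟨B, hB, rfl⟩ := List.mem_map.1 hx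
        exact key B hB
    _ ≤ m * n := by
        rw [List.length_map, smul_eq_mul]
        exact Nat.mul_le_mul_right n hm

theorem range_mem_psiLengths {s m n : ℕ} (hs : 1 ≤ s) (hm : 1 ≤ m) :
    n ∈ psiLengths s m n := by
  have hnd : (List.range n).Nodup := List.nodup_range
  refine ⟨List.range n, ⟨?_, ?_⟩, ?_, ⟨[List.range n], ?_, ?_, ?_⟩, ?_⟩
  · exact List.Pairwise.isChain hnd
  · rintro ⟨f, -, hf⟩
    have h1 : ((alternation (s + 2)).map f).Nodup := hf.nodup hnd
    have h2 : (alternation (s + 2)).Nodup := List.Nodup.of_map f h1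
    have h3 := List.inj_on_of_nodup_map (f := fun i => i % 2) h2
      (x := 0) (by simp) (y := 2) (by simp; omega) (by norm_num)
    omega
  · rw [List.toFinset_card_of_nodup hnd, List.length_range]
  · simpa using hm
  · simp
  · simp [hnd]
  · simp

/-- For positive `s`, `m` (and every `n`), `psi s m n` is a true maximum. -/
theorem psi_isGreatest {s m n : ℕ} (hs : 1 ≤ s) (hm : 1 ≤ m) :
    IsGreatest (psiLengths s m n) (psi s m n) :=
  have hb : BddAbove (psiLengths s m n) := ⟨m * n, fun _ h => psiLengths_le h⟩
  ⟨Nat.sSup_mem ⟨n, range_mem_psiLengths hs hm⟩ hb, fun _ h => le_csSup hb h⟩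

theorem succ_le_ackA (k : ℕ) : ∀ n, 1 ≤ n → n + 1 ≤ ackA (k + 1) n := by
  induction k with
  | zero => intro n hn; simp only [ackA]; omega
  | succ k ih =>
    intro n _
    induction n with
    | zero => simp [ackA]
    | succ n ihn =>
      have e : ackA (k + 1 + 1) (n + 1) = ackA (k + 1) (ackA (k + 1 + 1) n) := by
        simp only [ackA, Function.iterate_succ_apply']
      have h1 : n + 1 ≤ ackA (k + 1 + 1) n := by
        rcases Nat.eq_zero_or_pos n with rfl | hn
        · simp [ackA]
        · exact ihn hn
      have h2 := ih (ackA (k + 1 + 1) n) (by omega)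
      omega

/-- For `k ≥ 1` the minimum defining `alphaInv k x` is over a nonempty set. -/
theorem alphaInv_nonempty {k : ℕ} (hk : 1 ≤ k) (x : ℝ) :
    {n : ℕ | x ≤ (ackA k n : ℝ)}.Nonempty := by
  obtain ⟨k, rfl⟩ := Nat.exists_eq_add_of_le' hk
  obtain ⟨n, hn⟩ := exists_nat_ge x
  refine ⟨n + 1, hn.trans ?_⟩
  have := succ_le_ackA k (n + 1) (by omega)
  exact_mod_cast (by omega : n ≤ ackA (k + 1) (n + 1))

end DS

/-! The proof bounds, by recursion on the order, sequences cut into blocks of distinct symbols that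
only avoid a long alternation. Adjacent equal symbols are allowed, so the class is closed under
subsequences (`BlockBound`).

Cut the sequence into layers of `N` consecutive blocks. A symbol is local if it lies in one layer
and global otherwise. Occurrences of global symbols in their first or last layer can be prolonged by
one letter outside the layer, so there the order drops by one; in a middle layer it drops by two.
Counting the symbols of the middle parts means bounding the contracted sequence that keeps each
middle symbol once per layer: again the original order, but with few blocks (`layered_length_le`).

Apply the block bound of level `k` to the contracted sequence, and let `N` be a power of a shifted
Ackermann value large enough to absorb the polynomial factor there. Then one step j → j + 1 of the
next Ackermann function costs only an increment from y ^ (s - 2) to (y + 1) ^ (s - 2), with y = j +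
c (`BlockBound.step`, `blockBound_ackA`).

The constants obey the recurrence of `coeff`: up to bounded additive terms, the logarithm at (s, k)
is at most the sum of those at (s, k - 1) and (s - 2, k). Summing over `k`, from 5k + 2 at order 3
and about 2 ^ k at order 4, gives the stated exponents (`coeff_le`). -/

namespace DS

/-! ### Alternations and how they extend -/

/-- The alternation `a b a b ...` of length `r`. -/
def altList {α : Type*} : ℕ → α → α → List α
  | 0, _, _ => []
  | r + 1, a, b => a :: altList r b a

theorem map_alternation {α : Type*} (r : ℕ) (a b : α) :
    (alternation r).map (fun i => if i = 0 then a else b) = altList r a b := by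
  induction r generalizing a b with
  | zero => rfl
  | succ r ih =>
    rw [altList, ← ih b a, alternation, alternation, List.range_succ_eq_map]
    simp only [List.map_cons, List.map_map, Nat.zero_mod, if_true]
    congr 1
    apply List.map_congr_left
    intro i _
    rcases Nat.mod_two_eq_zero_or_one i with h | h
    · simp [h, Nat.add_mod]
    · simp [h, Nat.add_mod]

theorem altList_succ_append {α : Type*} (r : ℕ) (a b : α) :
    ∃ c, (c = a ∨ c = b) ∧ altList (r + 1) a b = altList r a b ++ [c] := by
  induction r generalizing a b with
  | zero => exact ⟨a, Or.inl rfl, rfl⟩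
  | succ r ih =>
    obtain ⟨c, hc, h⟩ := ih b a
    exact ⟨c, hc.symm, by rw [altList, h]; rfl⟩

theorem mem_altList {α : Type*} {r : ℕ} (hr : 2 ≤ r) (a b : α) :
    a ∈ altList r a b ∧ b ∈ altList r a b := by
  obtain ⟨r, rfl⟩ := Nat.exists_eq_add_of_le' hr
  simp [altList]

/-- `S` contains no alternation of length `r` of two different symbols. -/
def AltFree {α : Type*} (r : ℕ) (S : List α) : Prop :=
  ∀ a b, a ≠ b → ¬ (altList r a b).Sublist S

theorem AltFree.sublist {α : Type*} {r : ℕ} {S T : List α} (h : AltFree r S)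
    (hT : T.Sublist S) : AltFree r T :=
  fun a b hab hs => h a b hab (hs.trans hT)

theorem IsDS.altFree {α : Type*} {s : ℕ} {S : List α} (h : IsDS s S) : AltFree (s + 2) S := by
  intro a b hab hs
  refine h.2 ⟨fun i => if i = 0 then a else b, ?_, by rwa [map_alternation]⟩
  have key : ∀ x ∈ alternation (s + 2), x = 0 ∨ x = 1 := by
    intro x hx
    obtain ⟨i, -, rfl⟩ := List.mem_map.1 hx
    exact Nat.mod_two_eq_zero_or_one i
  intro x hx y hy hxy
  rcases key x hx with rfl | rfl <;> rcases key y hy with rfl | rfl <;> simp_all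

/-- If the symbols of `T` also occur later, then alternations in `T` extend to the right. -/
theorem AltFree.of_append {α : Type*} {r : ℕ} {S T U : List α} (hr : 2 ≤ r)
    (h : AltFree (r + 1) S) (hS : (T ++ U).Sublist S)
    {T' : List α} (hT : T'.Sublist T) (hU : ∀ a ∈ T', a ∈ U) : AltFree r T' := by
  intro a b hab hs
  obtain ⟨c, hc, e⟩ := altList_succ_append r a b
  refine h a b hab ?_
  rw [e]
  refine List.Sublist.trans ?_ hS
  refine (hs.trans hT).append (List.singleton_sublist.2 (hU c ?_))
  rcases hc with rfl | rfl
  · exact hs.subset (mem_altList hr _ _).1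
  · exact hs.subset (mem_altList hr _ _).2

/-! ### Concatenations of layers -/

theorem pair_sublist_range {i j b : ℕ} (hij : i < j) (hj : j < b) :
    [i, j].Sublist (List.range b) := by
  induction b with
  | zero => omega
  | succ b ih =>
    rw [List.range_succ]
    rcases Nat.lt_succ_iff_lt_or_eq.1 hj with h | rfl
    · exact (ih h).trans (List.sublist_append_left _ _)
    · exact List.Sublist.append (l₁ := [i]) (List.singleton_sublist.2 (List.mem_range.2 hij))
        (List.Sublist.refl _)

theorem append_sublist_flatten_range {α : Type*} (W : ℕ → List α) {i j b : ℕ} (hij : i < j)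
    (hj : j < b) : (W i ++ W j).Sublist ((List.range b).map W).flatten := by
  simpa using ((pair_sublist_range hij hj).map W).flatten

theorem length_flatten_range {α : Type*} (W : ℕ → List α) (b : ℕ) :
    ((List.range b).map W).flatten.length = ∑ i ∈ Finset.range b, (W i).length := by
  induction b with
  | zero => simp
  | succ b ih => simp [List.range_succ, Finset.sum_range_succ, ← ih]

theorem flatten_range_sublist {α : Type*} {V W : ℕ → List α} (b : ℕ)
    (h : ∀ i < b, (V i).Sublist (W i)) :
    ((List.range b).map V).flatten.Sublist ((List.range b).map W).flatten := by
  induction b with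
  | zero => simp
  | succ b ih =>
    simp only [List.range_succ, List.map_append, List.flatten_append, List.map_cons,
      List.map_nil, List.flatten_cons, List.flatten_nil, List.append_nil]
    exact (ih fun i hi => h i (by omega)).append (h b (by omega))

theorem flatten_range_mono {α : Type*} (W : ℕ → List α) {b c : ℕ} (h : b ≤ c) :
    ((List.range b).map W).flatten.Sublist ((List.range c).map W).flatten :=
  ((List.range_sublist.2 h).map W).flatten

/-! ### Block bounds and the smallest orders -/

/-- Every sequence of at most `M` blocks of distinct symbols, without alternations of length `r`,
has length at most `u` times the number of blocks plus `v` times the number of symbols. -/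
def BlockBound (r M u v : ℕ) : Prop :=
  ∀ L : List (List ℕ), (∀ B ∈ L, B.Nodup) → AltFree r L.flatten → L.length ≤ M →
    L.flatten.length ≤ u * L.length + v * L.flatten.toFinset.card

theorem BlockBound.mono {r M N u u' v v' : ℕ} (h : BlockBound r M u v) (hN : N ≤ M)
    (hu : u ≤ u') (hv : v ≤ v') : BlockBound r N u' v' := fun L h1 h2 h3 =>
  (h L h1 h2 (h3.trans hN)).trans
    (add_le_add (Nat.mul_le_mul_right _ hu) (Nat.mul_le_mul_right _ hv))

theorem BlockBound.trivial (r M : ℕ) : BlockBound r M 0 M := by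
  intro L hL _ hM
  rw [zero_mul, zero_add]
  have key : ∀ B ∈ L, B.length ≤ L.flatten.toFinset.card := by
    intro B hB
    rw [← List.toFinset_card_of_nodup (hL B hB)]
    apply Finset.card_le_card
    intro a ha
    rw [List.mem_toFinset] at ha ⊢
    exact List.mem_flatten.2 ⟨B, hB, ha⟩
  rw [List.length_flatten]
  calc (L.map List.length).sum ≤ (L.map List.length).length • L.flatten.toFinset.card := by
        apply List.sum_le_card_nsmul
        intro x hx
        obtain ⟨B, hB, rfl⟩ := List.mem_map.1 hx
        exact key B hB
    _ ≤ M * L.flatten.toFinset.card := by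
        rw [List.length_map, smul_eq_mul]
        exact Nat.mul_le_mul_right _ hM

/-- A block bound applied to the symbols satisfying a predicate. -/
theorem BlockBound.filter {r N u v : ℕ} (h : BlockBound r N u v) {X : List (List ℕ)}
    (hX : ∀ B ∈ X, B.Nodup) (hN : X.length ≤ N) (p : ℕ → Bool)
    (hp : AltFree r (X.flatten.filter p)) :
    (X.flatten.filter p).length ≤ u * X.length + v * (X.flatten.filter p).toFinset.card := by
  have := h (X.map (List.filter p)) (by
    intro B hB
    obtain ⟨B', hB', rfl⟩ := List.mem_map.1 hB
    exact (hX B' hB').filter p) (by rwa [← List.filter_flatten]) (by simpa using hN)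
  rwa [← List.filter_flatten, List.length_map] at this

theorem blockBound_two_one : BlockBound 2 1 1 0 := by
  intro L hL hf hl
  rw [zero_mul, add_zero, one_mul]
  match L, hl with
  | [], _ => simp
  | [B], _ =>
    match B with
    | [] => simp
    | [a] => simp
    | a :: b :: B =>
      have hne : a ≠ b := by
        have := hL _ (List.mem_singleton.2 rfl)
        simp only [List.nodup_cons, List.mem_cons, not_or] at this
        exact this.1.1
      exact absurd (by simp [altList]) (hf a b hne)

/-- Two symbols of a block that both recur later would give an alternation of length three, so each
block has at most one recurring symbol. Every other occurrence is the last of its symbol. -/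
theorem blockBound_three (M : ℕ) : BlockBound 3 M 1 1 := by
  intro L hL hf hM
  clear hM
  rw [one_mul, one_mul]
  induction L with
  | nil => simp
  | cons B L ih =>
    have ih' := ih (fun C hC => hL C (List.mem_cons_of_mem _ hC))
      (hf.sublist (by simp))
    classical
    have hBn : B.Nodup := hL B List.mem_cons_self
    have h1 : (B.filter (fun a => decide (a ∈ L.flatten))).length ≤ 1 := by
      have := blockBound_two_one.filter (X := [B]) (by simpa using hBn) (by simp)
        (fun a => decide (a ∈ L.flatten)) (by
          simp only [List.flatten_cons, List.flatten_nil, List.append_nil]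
          exact AltFree.of_append le_rfl hf (T := B) (U := L.flatten) (by simp)
            List.filter_sublist (fun a ha => by simpa using (List.mem_filter.1 ha).2))
      simpa using this
    have h2 : (B.filter (fun a => !decide (a ∈ L.flatten))).length +
        L.flatten.toFinset.card ≤ (B :: L).flatten.toFinset.card := by
      rw [← List.toFinset_card_of_nodup (hBn.filter _), ← Finset.card_union_of_disjoint]
      · apply Finset.card_le_card
        intro a ha
        simp only [Finset.mem_union, List.mem_toFinset, List.mem_filter] at ha ⊢
        rw [List.flatten_cons, List.mem_append]
        tauto
      · rw [Finset.disjoint_left]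
        intro a ha hb
        rw [List.mem_toFinset] at ha hb
        simpa [hb] using (List.mem_filter.1 ha).2
    have h3 := List.length_eq_length_filter_add (l := B) (fun a => decide (a ∈ L.flatten))
    rw [List.flatten_cons, List.length_append, List.length_cons]
    rw [List.flatten_cons] at h2
    omega

/-! ### The layered recurrence -/

theorem length_le_four_filters {α : Type*} (T : List α) (p₁ p₂ p₃ p₄ : α → Bool)
    (h : ∀ a ∈ T, p₁ a || p₂ a || p₃ a || p₄ a) :
    T.length ≤ (T.filter p₁).length + (T.filter p₂).length + (T.filter p₃).length +
      (T.filter p₄).length := by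
  induction T with
  | nil => simp
  | cons a T ih =>
    have := ih fun x hx => h x (List.mem_cons_of_mem _ hx)
    have ha := h a List.mem_cons_self
    simp only [List.filter_cons, List.length_cons]
    cases h1 : p₁ a <;> cases h2 : p₂ a <;> cases h3 : p₃ a <;> cases h4 : p₄ a <;>
      simp [h1, h2, h3, h4] at ha ⊢ <;> omega

theorem triple_sublist_range {k i j b : ℕ} (hki : k < i) (hij : i < j) (hj : j < b) :
    [k, i, j].Sublist (List.range b) := by
  have h : [j].Sublist ((List.range (b - (i + 1))).map (i + 1 + ·)) :=
    List.singleton_sublist.2 (List.mem_map.2 ⟨j - (i + 1), List.mem_range.2 (by omega), by omega⟩)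
  refine ((pair_sublist_range hki (Nat.lt_succ_self i)).append h).trans ?_
  rw [← List.range_add]
  exact List.range_sublist.2 (by omega)

/-- The layered recurrence: `X 0, ..., X (b - 1)` are groups of consecutive blocks, `p` counts
the symbols that occur in one layer only, and `q` the other symbols. -/
theorem layered_length_le {r N b u₀ v₀ u₁ v₁ u₂ v₂ u₃ v₃ : ℕ} (hr : 2 ≤ r)
    (h₀ : BlockBound (r + 2) N u₀ v₀) (h₁ : BlockBound (r + 1) N u₁ v₁)
    (h₂ : BlockBound r N u₂ v₂) (h₃ : BlockBound (r + 2) (b - 1) u₃ v₃)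
    (X : ℕ → List (List ℕ)) (hnd : ∀ i < b, ∀ B ∈ X i, B.Nodup)
    (hN : ∀ i < b, (X i).length ≤ N)
    (hfree : AltFree (r + 2) ((List.range b).map fun i => (X i).flatten).flatten) :
    ∃ p q, p + q ≤ ((List.range b).map fun i => (X i).flatten).flatten.toFinset.card ∧
      ((List.range b).map fun i => (X i).flatten).flatten.length ≤
        (u₀ + 2 * u₁ + u₂) * (∑ i ∈ Finset.range b, (X i).length) + v₀ * p + 2 * v₁ * q +
          v₂ * (u₃ * (b - 1) + v₃ * q) := by
  classical
  set W : ℕ → List ℕ := fun i => (X i).flatten with hW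
  set S := ((List.range b).map W).flatten with hS
  have memS : ∀ {i a}, i < b → a ∈ W i → a ∈ S := by
    intro i a hi ha
    exact List.mem_flatten.2 ⟨W i, List.mem_map.2 ⟨i, List.mem_range.2 hi, rfl⟩, ha⟩
  let glob : ℕ → Prop := fun a => ∃ i j, i < j ∧ j < b ∧ a ∈ W i ∧ a ∈ W j
  let before : ℕ → ℕ → Prop := fun i a => ∃ j < i, a ∈ W j
  let after : ℕ → ℕ → Prop := fun i a => ∃ j, i < j ∧ j < b ∧ a ∈ W j
  let loc : ℕ → List ℕ := fun i => (W i).filter fun a => decide (¬ glob a)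
  let fst : ℕ → List ℕ := fun i => (W i).filter fun a => decide (¬ before i a ∧ after i a)
  let lst : ℕ → List ℕ := fun i => (W i).filter fun a => decide (before i a ∧ ¬ after i a)
  let mid : ℕ → List ℕ := fun i => (W i).filter fun a => decide (before i a ∧ after i a)
  let G : Finset ℕ := S.toFinset.filter glob
  have globS : ∀ {a}, glob a → a ∈ G := by
    rintro a ha
    obtain ⟨i, j, hij, hj, hi, -⟩ := id ha
    exact Finset.mem_filter.2 ⟨List.mem_toFinset.2 (memS (hij.trans hj) hi), ha⟩
  have split : ∀ i < b, (W i).length ≤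
      (loc i).length + (fst i).length + (lst i).length + (mid i).length := by
    intro i hi
    refine length_le_four_filters _ _ _ _ _ fun a _ => ?_
    simp only [Bool.or_eq_true, decide_eq_true_eq]
    by_cases h1 : before i a <;> by_cases h2 : after i a <;>
      simp only [h1, h2, not_true, not_false_iff, true_and, and_true, false_and, or_false, or_true]
    rintro ⟨j, k, hjk, hk, hj, hk'⟩
    have h3 : ¬ j < i := fun h => h1 ⟨j, h, hj⟩
    exact h2 ⟨k, by omega, hk, hk'⟩
  have hloc : ∀ i ∈ Finset.range b,
      (loc i).length ≤ u₀ * (X i).length + v₀ * (loc i).toFinset.card := by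
    intro i hi
    rw [Finset.mem_range] at hi
    refine h₀.filter (hnd i hi) (hN i hi) _ (hfree.sublist (List.filter_sublist.trans ?_))
    exact List.sublist_flatten_of_mem (List.mem_map.2 ⟨i, List.mem_range.2 hi, rfl⟩)
  -- Every symbol here recurs in a later layer, so an alternation gains a letter on the right; for
  -- last layers it gains one on the left, for middle layers one on each side.
  have hfst' : ∀ i < b, AltFree (r + 1) (fst i) := by
    intro i hi a c hac hs
    have hmem := mem_altList (by omega : 2 ≤ r + 1) a c
    obtain ⟨d, hd, e⟩ := altList_succ_append (r + 1) a c
    have hd' : d ∈ fst i := by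
      rcases hd with rfl | rfl
      exacts [hs.subset hmem.1, hs.subset hmem.2]
    have hd2 := (List.mem_filter.1 hd').2
    simp only [decide_eq_true_eq] at hd2
    obtain ⟨-, j, hij, hj, hdj⟩ := hd2
    refine hfree a c hac ?_
    rw [e]
    exact ((hs.trans List.filter_sublist).append (List.singleton_sublist.2 hdj)).trans
      (append_sublist_flatten_range W hij hj)
  have hlst' : ∀ i < b, AltFree (r + 1) (lst i) := by
    intro i hi a c hac hs
    have hmem := mem_altList (by omega : 2 ≤ r + 1) a c
    have hd2 := (List.mem_filter.1 (hs.subset hmem.2)).2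
    simp only [decide_eq_true_eq] at hd2
    obtain ⟨⟨j, hij, hj⟩, -⟩ := hd2
    refine hfree c a hac.symm ?_
    exact ((List.singleton_sublist.2 hj).append (hs.trans List.filter_sublist)).trans
      (append_sublist_flatten_range W hij hi)
  have hmid' : ∀ i < b, AltFree r (mid i) := by
    intro i hi a c hac hs
    have hmem := mem_altList hr a c
    obtain ⟨d, hd, e⟩ := altList_succ_append r a c
    have hd' : d ∈ mid i := by
      rcases hd with rfl | rfl
      exacts [hs.subset hmem.1, hs.subset hmem.2]
    have hd2 := (List.mem_filter.1 hd').2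
    have hc2 := (List.mem_filter.1 (hs.subset hmem.2)).2
    simp only [decide_eq_true_eq] at hd2 hc2
    obtain ⟨-, j, hij, hj, hdj⟩ := hd2
    obtain ⟨⟨k, hki, hk⟩, -⟩ := hc2
    refine hfree c a hac.symm ?_
    have h3 : (W k ++ (W i ++ W j)).Sublist S := by
      simpa using ((triple_sublist_range hki hij hj).map W).flatten
    refine List.Sublist.trans ?_ h3
    rw [show altList (r + 2) c a = [c] ++ altList (r + 1) a c from rfl, e]
    exact (List.singleton_sublist.2 hk).append
      ((hs.trans List.filter_sublist).append (List.singleton_sublist.2 hdj))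
  have hfst : ∀ i ∈ Finset.range b,
      (fst i).length ≤ u₁ * (X i).length + v₁ * (fst i).toFinset.card := fun i hi =>
    h₁.filter (hnd i (Finset.mem_range.1 hi)) (hN i (Finset.mem_range.1 hi)) _
      (hfst' i (Finset.mem_range.1 hi))
  have hlst : ∀ i ∈ Finset.range b,
      (lst i).length ≤ u₁ * (X i).length + v₁ * (lst i).toFinset.card := fun i hi =>
    h₁.filter (hnd i (Finset.mem_range.1 hi)) (hN i (Finset.mem_range.1 hi)) _
      (hlst' i (Finset.mem_range.1 hi))
  have hmid : ∀ i ∈ Finset.range b,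
      (mid i).length ≤ u₂ * (X i).length + v₂ * (mid i).toFinset.card := fun i hi =>
    h₂.filter (hnd i (Finset.mem_range.1 hi)) (hN i (Finset.mem_range.1 hi)) _
      (hmid' i (Finset.mem_range.1 hi))
  have cloc : ∑ i ∈ Finset.range b, (loc i).toFinset.card + G.card ≤ S.toFinset.card := by
    rw [← Finset.card_biUnion, ← Finset.card_union_of_disjoint]
    · apply Finset.card_le_card
      intro a ha
      rcases Finset.mem_union.1 ha with h | h
      · obtain ⟨i, hi, h⟩ := Finset.mem_biUnion.1 h
        rw [List.mem_toFinset] at h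
        exact List.mem_toFinset.2 (memS (Finset.mem_range.1 hi) (List.mem_filter.1 h).1)
      · exact (Finset.mem_filter.1 h).1
    · rw [Finset.disjoint_left]
      intro a ha hG
      obtain ⟨i, -, h⟩ := Finset.mem_biUnion.1 ha
      rw [List.mem_toFinset] at h
      have h2 := (List.mem_filter.1 h).2
      rw [decide_eq_true_eq] at h2
      exact h2 (Finset.mem_filter.1 hG).2
    · intro i hi j hj hij
      rw [Finset.mem_coe, Finset.mem_range] at hi hj
      refine Finset.disjoint_left.2 fun a ha hb => ?_
      rw [List.mem_toFinset, List.mem_filter, decide_eq_true_eq] at ha hb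
      rcases lt_or_gt_of_ne hij with h | h
      · exact ha.2 ⟨i, j, h, hj, ha.1, hb.1⟩
      · exact ha.2 ⟨j, i, h, hi, hb.1, ha.1⟩
  have cfst : ∑ i ∈ Finset.range b, (fst i).toFinset.card ≤ G.card := by
    rw [← Finset.card_biUnion]
    · apply Finset.card_le_card
      intro a ha
      obtain ⟨i, hi, h⟩ := Finset.mem_biUnion.1 ha
      rw [List.mem_toFinset, List.mem_filter, decide_eq_true_eq] at h
      obtain ⟨h, -, j, hij, hj, hja⟩ := h
      exact globS ⟨i, j, hij, hj, h, hja⟩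
    · intro i hi j hj hij
      refine Finset.disjoint_left.2 fun a ha hb => ?_
      rw [List.mem_toFinset, List.mem_filter, decide_eq_true_eq] at ha hb
      rcases lt_or_gt_of_ne hij with h | h
      · exact hb.2.1 ⟨i, h, ha.1⟩
      · exact ha.2.1 ⟨j, h, hb.1⟩
  have clst : ∑ i ∈ Finset.range b, (lst i).toFinset.card ≤ G.card := by
    rw [← Finset.card_biUnion]
    · apply Finset.card_le_card
      intro a ha
      obtain ⟨i, hi, h⟩ := Finset.mem_biUnion.1 ha
      rw [List.mem_toFinset, List.mem_filter, decide_eq_true_eq] at h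
      obtain ⟨h, ⟨j, hij, hja⟩, -⟩ := h
      exact globS ⟨j, i, hij, Finset.mem_range.1 hi, hja, h⟩
    · intro i hi j hj hij
      rw [Finset.mem_coe, Finset.mem_range] at hi hj
      refine Finset.disjoint_left.2 fun a ha hb => ?_
      rw [List.mem_toFinset, List.mem_filter, decide_eq_true_eq] at ha hb
      rcases lt_or_gt_of_ne hij with h | h
      · exact ha.2.2 ⟨j, h, hj, hb.1⟩
      · exact hb.2.2 ⟨i, h, hi, ha.1⟩
  have cmid : ∑ i ∈ Finset.range b, (mid i).toFinset.card ≤ u₃ * (b - 1) + v₃ * G.card := by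
    have e : ∑ i ∈ Finset.range b, (mid i).toFinset.card =
        -- The last layer has no middle occurrences. Having `b - 1` blocks rather than `b` matters,
        -- since only `b - 1` layers are guaranteed to be full.
        ∑ i ∈ Finset.range (b - 1), (mid i).dedup.length := by
      rcases b with - | b
      · simp
      · rw [Finset.sum_range_succ]
        have : mid b = [] := by
          rw [List.filter_eq_nil_iff]
          intro a _ h
          rw [decide_eq_true_eq] at h
          obtain ⟨-, j, h1, h2, -⟩ := h
          omega
        simp [this, List.card_toFinset]
    rw [e, ← length_flatten_range fun i => (mid i).dedup]
    have hsub : ((List.range (b - 1)).map fun i => (mid i).dedup).flatten.Sublist S :=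
      (flatten_range_sublist (b - 1) fun i _ =>
        (List.dedup_sublist _).trans List.filter_sublist).trans
        (flatten_range_mono W (Nat.sub_le b 1))
    refine (h₃ _ ?_ (hfree.sublist hsub) (by simp)).trans ?_
    · intro B hB
      obtain ⟨i, -, rfl⟩ := List.mem_map.1 hB
      exact List.nodup_dedup _
    · rw [List.length_map, List.length_range]
      refine Nat.add_le_add_left (Nat.mul_le_mul_left _ (Finset.card_le_card ?_)) _
      intro a ha
      rw [List.mem_toFinset] at ha
      obtain ⟨B, hB, haB⟩ := List.mem_flatten.1 ha
      obtain ⟨i, -, rfl⟩ := List.mem_map.1 hB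
      rw [List.mem_dedup, List.mem_filter, decide_eq_true_eq] at haB
      obtain ⟨-, ⟨j, hj, hja⟩, k, hk, hkb, hka⟩ := haB
      exact globS ⟨j, k, hj.trans hk, hkb, hja, hka⟩
  refine ⟨∑ i ∈ Finset.range b, (loc i).toFinset.card, G.card, cloc, ?_⟩
  have total := Finset.sum_le_sum fun i hi => (split i (Finset.mem_range.1 hi))
  simp only [Finset.sum_add_distrib] at total
  have t₀ := Finset.sum_le_sum hloc
  have t₁ := Finset.sum_le_sum hfst
  have t₂ := Finset.sum_le_sum hlst
  have t₃ := Finset.sum_le_sum hmid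
  simp only [Finset.sum_add_distrib, ← Finset.mul_sum] at t₀ t₁ t₂ t₃
  have cfst' := Nat.mul_le_mul_left v₁ cfst
  have clst' := Nat.mul_le_mul_left v₁ clst
  have cmid' := Nat.mul_le_mul_left v₂ cmid
  rw [length_flatten_range]
  linarith

theorem exists_layers {N : ℕ} (hN : 1 ≤ N) {α : Type*} (L : List α) :
    ∃ (b : ℕ) (X : ℕ → List α), ((List.range b).map X).flatten = L ∧
      (∀ i < b, (X i).length ≤ N) ∧ (b - 1) * N ≤ L.length := by
  induction h : L.length using Nat.strong_induction_on generalizing L with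
  | _ n ih =>
    subst h
    rcases Nat.lt_or_ge N L.length with h | h
    · obtain ⟨b, X, h1, h2, h3⟩ := ih (L.drop N).length (by rw [List.length_drop]; omega) _ rfl
      refine ⟨b + 1, fun i => Nat.casesOn i (L.take N) X, ?_, ?_, ?_⟩
      · rw [List.range_succ_eq_map]
        simp only [List.map_cons, List.map_map, List.flatten_cons]
        rw [show ((fun i => Nat.casesOn i (L.take N) X : ℕ → List α) ∘ Nat.succ) = X from rfl, h1]
        exact List.take_append_drop _ _
      · rintro (- | i) hi
        · simp
        · exact h2 i (by omega)
      · rw [List.length_drop] at h3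
        rcases b with - | b
        · simp
        · simp only [Nat.add_sub_cancel] at h3 ⊢
          rw [Nat.succ_mul]
          omega
    · exact ⟨1, fun _ => L, by simp, by simpa using h, by simp⟩

/-- With all layers but perhaps the last full, (b - 1) * N is at most the number of blocks. Hence
`u₃` per block of the contracted sequence costs at most `w` per original block. -/
theorem BlockBound.layered {r M M' N u₀ v₀ u₁ v₁ u₂ v₂ u₃ v₃ u v : ℕ} (hr : 2 ≤ r) (hN : 1 ≤ N)
    (h₀ : BlockBound (r + 2) N u₀ v₀) (h₁ : BlockBound (r + 1) N u₁ v₁)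
    (h₂ : BlockBound r N u₂ v₂) (h₃ : BlockBound (r + 2) M' u₃ v₃)
    (hM : ∀ d, d * N ≤ M → d ≤ M') {w : ℕ} (hw : u₃ ≤ w * N)
    (hu : u₀ + 2 * u₁ + u₂ + v₂ * w ≤ u) (hv₀ : v₀ ≤ v) (hv : 2 * v₁ + v₂ * v₃ ≤ v) :
    BlockBound (r + 2) M u v := by
  intro L hL hf hLM
  obtain ⟨b, X, rfl, hXN, hb⟩ := exists_layers hN L
  have e : ((List.range b).map X).flatten.flatten =
      ((List.range b).map fun i => (X i).flatten).flatten := by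
    rw [List.flatten_flatten, List.map_map]; rfl
  have hb' : b - 1 ≤ M' := hM _ (hb.trans hLM)
  rw [e] at hf ⊢
  obtain ⟨p, q, hpq, h⟩ := layered_length_le (b := b) hr h₀ h₁ h₂ (h₃.mono hb' le_rfl le_rfl) X
    (fun i hi B hB => hL B (List.mem_flatten.2
      ⟨X i, List.mem_map.2 ⟨i, List.mem_range.2 hi, rfl⟩, hB⟩)) hXN hf
  refine h.trans ?_
  rw [length_flatten_range] at hb ⊢
  set m := ∑ i ∈ Finset.range b, (X i).length
  have k1 : u₃ * (b - 1) ≤ w * m := by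
    calc u₃ * (b - 1) ≤ w * N * (b - 1) := Nat.mul_le_mul_right _ hw
      _ = w * ((b - 1) * N) := by ring
      _ ≤ w * m := Nat.mul_le_mul_left _ hb
  have k2 := Nat.mul_le_mul_left v₂ k1
  have k3 := Nat.mul_le_mul_right m hu
  have k4 := Nat.mul_le_mul_right p hv₀
  have k5 := Nat.mul_le_mul_right q hv
  have k6 := Nat.mul_le_mul_left v hpq
  linarith

theorem BlockBound.one (r : ℕ) : BlockBound r 1 0 1 := BlockBound.trivial r 1

/-- Take single blocks as layers. A middle part then has at most one symbol, so v₂ = 0 and the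
contracted sequence does not enter. -/
theorem blockBound_four (M : ℕ) : BlockBound 4 M 1 2 :=
  BlockBound.layered le_rfl le_rfl (BlockBound.one 4) (BlockBound.one 3) blockBound_two_one
    (BlockBound.trivial 4 M) (M' := M) (w := 0) (by simp) (by simp) (by simp) (by simp) (by simp)

/-! ### Coefficients and the inductive step -/

/-- The coefficients in the upper bounds for `ψ_s`. -/
def coeff : ℕ → ℕ → ℕ
  | _, 0 => 2
  | 0, _ + 1 => 1
  | 1, _ + 1 => 1
  | 2, _ + 1 => 2
  | s + 3, k + 1 => 2 * coeff (s + 2) (k + 1) + coeff (s + 1) (k + 1) * (1 + coeff (s + 3) k)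

theorem coeff_zero (s : ℕ) : coeff s 0 = 2 := by
  rcases s with - | - | - | s <;> rw [coeff]

theorem coeff_one_succ (k : ℕ) : coeff 1 (k + 1) = 1 := by rw [coeff]

theorem coeff_two_succ (k : ℕ) : coeff 2 (k + 1) = 2 := by rw [coeff]

theorem coeff_add_three (s k : ℕ) : coeff (s + 3) (k + 1) =
    2 * coeff (s + 2) (k + 1) + coeff (s + 1) (k + 1) * (1 + coeff (s + 3) k) := by rw [coeff]

theorem coeff_pos (s : ℕ) : ∀ k, 1 ≤ coeff s k := by
  induction s using Nat.strong_induction_on with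
  | _ s ih =>
    rintro (- | k)
    · rw [coeff_zero]; omega
    · rcases s with - | - | - | s
      · rw [coeff]
      · rw [coeff]
      · rw [coeff]; omega
      · rw [coeff_add_three]
        have := ih (s + 2) (by omega) (k + 1)
        omega

/-- Monotonicity starts at level one: the level-zero value 2 exceeds `coeff 1 1`. -/
theorem coeff_one_le (s : ℕ) (hs : 1 ≤ s) (k : ℕ) : coeff s 1 ≤ coeff s (k + 1) := by
  induction k with
  | zero => rfl
  | succ k ih =>
    refine ih.trans ?_
    clear ih
    obtain ⟨s, rfl⟩ := Nat.exists_eq_add_of_le' hs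
    rcases s with - | - | s
    · rw [coeff, coeff]
    · rw [coeff, coeff]
    · change coeff (s + 3) (k + 1) ≤ coeff (s + 3) (k + 1 + 1)
      rw [coeff_add_three s (k + 1)]
      have := Nat.mul_le_mul_right (1 + coeff (s + 3) (k + 1)) (coeff_pos (s + 1) (k + 1 + 1))
      omega

theorem pred_pow_add_pow_le (x p : ℕ) : x ^ (p + 1) + (x + 1) ^ p ≤ (x + 1) ^ (p + 1) := by
  have := Nat.mul_le_mul_right x (Nat.pow_le_pow_left (Nat.le_succ x) p)
  rw [pow_succ, pow_succ (x + 1)]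
  linarith

/-- One step of the induction: from layers of `N` blocks and a bound for the contracted
sequence to sequences of `M` blocks. -/
theorem BlockBound.step {s M M' N k y u₃ : ℕ} (hN : 1 ≤ N)
    (h₀ : BlockBound (s + 5) N (coeff (s + 3) (k + 1) * y ^ (s + 1)) (coeff (s + 3) (k + 1)))
    (h₁ : BlockBound (s + 4) N (coeff (s + 2) (k + 1) * (y + 1) ^ s) (coeff (s + 2) (k + 1)))
    (h₂ : BlockBound (s + 3) N (coeff (s + 1) (k + 1) * (y + 1) ^ (s - 1))
      (coeff (s + 1) (k + 1)))
    (h₃ : BlockBound (s + 5) M' u₃ (coeff (s + 3) k))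
    (hM : ∀ d, d * N ≤ M → d ≤ M') (hu₃ : u₃ ≤ coeff (s + 3) k * N) :
    BlockBound (s + 5) M (coeff (s + 3) (k + 1) * (y + 1) ^ (s + 1)) (coeff (s + 3) (k + 1)) := by
  refine BlockBound.layered (r := s + 3) (by omega) hN h₀ h₁ h₂ h₃ hM hu₃ ?_ le_rfl ?_
  -- Passing from y to y + 1 frees (y + 1) ^ s copies of the leading coefficient, which by its
  -- recurrence pays for the three lower-order and contracted terms.
  · have h := Nat.mul_le_mul_left (coeff (s + 3) (k + 1)) (pred_pow_add_pow_le y s)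
    refine le_trans ?_ h
    rw [mul_add, add_assoc, add_assoc]
    refine Nat.add_le_add_left ?_ _
    rw [coeff_add_three, add_mul, mul_assoc 2]
    refine Nat.add_le_add_left ?_ _
    rw [mul_add, mul_one, add_mul]
    refine add_le_add (Nat.mul_le_mul_left _ (Nat.pow_le_pow_right (by omega) (by omega))) ?_
    exact Nat.le_mul_of_pos_right _ (Nat.pow_pos (by omega))
  · rw [coeff_add_three, mul_add, mul_one]
    omega

theorem blockBound_order_one (k y M : ℕ) :
    BlockBound (1 + 2) M (coeff 1 (k + 1) * y ^ (1 - 2)) (coeff 1 (k + 1)) := by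
  simpa [coeff_one_succ] using blockBound_three M

theorem blockBound_order_two (k y M : ℕ) :
    BlockBound (2 + 2) M (coeff 2 (k + 1) * y ^ (2 - 2)) (coeff 2 (k + 1)) := by
  simpa [coeff_two_succ] using (blockBound_four M).mono le_rfl one_le_two le_rfl

/-- Doubling the number of blocks leaves at most two blocks in the contracted sequence, where each
symbol occurs at most twice; this is the level-zero coefficient 2. -/
theorem blockBound_two_pow (s : ℕ) (hs : 1 ≤ s) : ∀ J,
    BlockBound (s + 2) (2 ^ J) (coeff s 1 * J ^ (s - 2)) (coeff s 1) := by
  induction s using Nat.strong_induction_on with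
  | _ s ih =>
    intro J
    rcases s with - | - | - | s
    · omega
    · exact blockBound_order_one 0 J _
    · exact blockBound_order_two 0 J _
    · induction J with
      | zero => exact (BlockBound.one _).mono le_rfl (Nat.zero_le _) (coeff_pos _ _)
      | succ J ihJ =>
        have hle : 2 ^ J ≤ 2 ^ (J + 1) := Nat.pow_le_pow_right (by omega) (by omega)
        refine BlockBound.step (N := 2 ^ J) Nat.one_le_two_pow ihJ
          ((ih (s + 2) (by omega) (by omega) (J + 1)).mono hle le_rfl le_rfl)
          ((ih (s + 1) (by omega) (by omega) (J + 1)).mono hle le_rfl le_rfl)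
          ((BlockBound.trivial _ 2).mono le_rfl le_rfl (coeff_zero _).ge) ?_ (Nat.zero_le _)
        intro d hd
        rw [pow_succ'] at hd
        exact Nat.le_of_mul_le_mul_right hd (by positivity)

/-! ### Induction along the Ackermann hierarchy -/

theorem ackA_succ_succ (k j : ℕ) : ackA (k + 2) (j + 1) = ackA (k + 1) (ackA (k + 2) j) := by
  simp only [ackA, Function.iterate_succ_apply']

theorem le_ackA (k j : ℕ) : j ≤ ackA (k + 1) j := by
  rcases Nat.eq_zero_or_pos j with rfl | h
  · exact Nat.zero_le _
  · exact (Nat.le_succ j).trans (succ_le_ackA k j h)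

theorem ackA_mono (k : ℕ) : Monotone (ackA (k + 1)) := by
  refine monotone_nat_of_le_succ fun j => ?_
  rcases k with - | k
  · simp only [ackA]; omega
  · rw [ackA_succ_succ]
    exact le_ackA k _

/-- The main bound: here `P` and `c` are arbitrary constants with `(2 * x) ^ P ≤ 2 ^ x` for
`x ≥ c`. -/
theorem blockBound_ackA {P c : ℕ} (hc : 1 ≤ c) (hP : ∀ x, c ≤ x → (2 * x) ^ P ≤ 2 ^ x)
    (s : ℕ) (hs : 1 ≤ s) (hsP : s - 2 ≤ P) : ∀ k j,
    BlockBound (s + 2) ((ackA (k + 1) j + c) ^ P) (coeff s (k + 1) * (j + c) ^ (s - 2))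
      (coeff s (k + 1)) := by
  induction s using Nat.strong_induction_on with
  | _ s ih =>
    rcases s with - | - | - | s
    · omega
    · exact fun k j => blockBound_order_one k _ _
    · exact fun k j => blockBound_order_two k _ _
    · intro k
      induction k with
      | zero =>
        intro j
        refine (blockBound_two_pow (s + 3) hs (j + c)).mono ?_ le_rfl le_rfl
        refine le_trans (Nat.pow_le_pow_left ?_ P) (hP (j + c) (by omega))
        simp only [ackA]; omega
      | succ k ihk =>
        intro j
        induction j with
        | zero =>
          -- Since A_{k+2}(0) = 1, at most (1 + c) ^ P ≤ 2 ^ c blocks occur, and the doubling bound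
          -- suffices.
          have hmono := coeff_one_le (s + 3) hs (k + 1)
          refine (blockBound_two_pow (s + 3) hs c).mono ?_ ?_ hmono
          · refine le_trans (Nat.pow_le_pow_left ?_ P) (hP c le_rfl)
            simp only [ackA, Function.iterate_zero, id]; omega
          · rw [zero_add]
            exact Nat.mul_le_mul_right _ hmono
        | succ j ihj =>
          set x := ackA (k + 2) j with hx
          have hNpos : 1 ≤ (x + c) ^ P := Nat.pow_pos (by omega)
          have hle : (x + c) ^ P ≤ (ackA (k + 2) (j + 1) + c) ^ P :=
            Nat.pow_le_pow_left (Nat.add_le_add_right (ackA_mono (k + 1) (Nat.le_succ j)) c) P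
          have e : j + 1 + c = j + c + 1 := by omega
          have h₁ := (ih (s + 2) (by omega) (by omega) (by omega) (k + 1) (j + 1)).mono hle
            le_rfl le_rfl
          have h₂ := (ih (s + 1) (by omega) (by omega) (by omega) (k + 1) (j + 1)).mono hle
            le_rfl le_rfl
          rw [e] at h₁ h₂ ⊢
          -- Layers have (x + c) ^ P blocks, and the contracted sequence uses level `k` at argument
          -- `x`. Its factor (x + c) ^ (s + 1) is at most the layer size because s + 1 ≤ P.
          refine BlockBound.step hNpos ihj h₁ h₂ (ihk x) ?_ ?_
          · intro d hd
            rw [ackA_succ_succ] at hd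
            exact (Nat.le_mul_of_pos_right d hNpos).trans hd
          · exact Nat.mul_le_mul_left _ (Nat.pow_le_pow_right (by omega) hsP)

theorem exists_two_mul_pow_le (P : ℕ) : ∃ c, 1 ≤ c ∧ ∀ x, c ≤ x → (2 * x) ^ P ≤ 2 ^ x := by
  have h := tendsto_pow_const_div_const_pow_of_one_lt P (r := 2) one_lt_two
  have h2 := h.eventually (Iio_mem_nhds (show (0 : ℝ) < 1 / 2 ^ P by positivity))
  obtain ⟨c, hc⟩ := Filter.eventually_atTop.1 h2
  refine ⟨c + 1, by omega, fun x hx => ?_⟩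
  have h3 := hc x (by omega)
  rw [div_lt_div_iff₀ (by positivity) (by positivity), one_mul] at h3
  have h4 : ((2 * x : ℕ) : ℝ) ^ P ≤ 2 ^ x := by
    push_cast
    rw [mul_pow]
    linarith
  exact_mod_cast h4

/-! ### From block bounds to `psi` -/

theorem le_ackA_alphaInv {k : ℕ} (m : ℕ) : m ≤ ackA (k + 1) (alphaInv (k + 1) m) := by
  have : (m : ℝ) ≤ (ackA (k + 1) (alphaInv (k + 1) m) : ℝ) :=
    Nat.sInf_mem (alphaInv_nonempty (k := k + 1) (by omega) (m : ℝ))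
  exact_mod_cast this

theorem psi_one_le {s n : ℕ} (hs : 1 ≤ s) : psi s 1 n ≤ n := by
  simpa using psiLengths_le (psi_isGreatest (s := s) (m := 1) (n := n) hs le_rfl).1

theorem psi_le_of_blockBound {s m n M u v : ℕ} (hs : 1 ≤ s) (hm : 1 ≤ m)
    (h : BlockBound (s + 2) M u v) (hM : m ≤ M) : psi s m n ≤ u * m + v * n := by
  obtain ⟨S, hS, hn, ⟨L, hL, rfl, hnd⟩, hl⟩ := (psi_isGreatest (s := s) (n := n) hs hm).1
  rw [← hl, ← hn]
  exact (h L hnd hS.altFree (hL.trans hM)).trans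
    (Nat.add_le_add_right (Nat.mul_le_mul_left u hL) _)

theorem exists_psi_le (s : ℕ) (hs : 3 ≤ s) : ∃ c : ℕ, 1 ≤ c ∧ ∀ k m n : ℕ, 1 ≤ k → 1 ≤ m →
    psi s m n ≤ c * coeff s k * (m * alphaInv k m ^ (s - 2) + n) := by
  obtain ⟨c, hc, hP⟩ := exists_two_mul_pow_le (s - 2)
  refine ⟨(1 + c) ^ (s - 2), Nat.pow_pos (by omega), fun k m n hk hm => ?_⟩
  obtain ⟨k, rfl⟩ := Nat.exists_eq_add_of_le' hk
  have hK := coeff_pos s (k + 1)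
  have hcp : 1 ≤ (1 + c) ^ (s - 2) := Nat.pow_pos (by omega)
  set j := alphaInv (k + 1) m with hj
  have hmj : m ≤ ackA (k + 1) j := le_ackA_alphaInv m
  rcases Nat.eq_zero_or_pos j with h0 | hpos
  -- A vanishing inverse value cannot absorb the shift `c`, but it forces a single block.
  · have hm1 : m = 1 := by
      rw [h0] at hmj
      rcases k with - | k <;> simp [ackA] at hmj <;> omega
    have h1 : psi s m n ≤ n := by rw [hm1]; exact psi_one_le (by omega)
    calc psi s m n ≤ 1 * (m * j ^ (s - 2) + n) := by omega
      _ ≤ _ := Nat.mul_le_mul_right _ (Nat.mul_pos hcp hK)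
  · have h1 := psi_le_of_blockBound (n := n) (by omega) hm
      (blockBound_ackA hc hP s (by omega) le_rfl k j)
      (hmj.trans ((Nat.le_add_right _ c).trans (Nat.le_self_pow (by omega) _)))
    refine h1.trans ?_
    have h2 : (j + c) ^ (s - 2) ≤ (1 + c) ^ (s - 2) * j ^ (s - 2) := by
      rw [← mul_pow]
      refine Nat.pow_le_pow_left ?_ _
      nlinarith
    rw [mul_add]
    refine add_le_add ?_ (Nat.mul_le_mul_right n (Nat.le_mul_of_pos_left _ hcp))
    calc coeff s (k + 1) * (j + c) ^ (s - 2) * m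
        ≤ coeff s (k + 1) * ((1 + c) ^ (s - 2) * j ^ (s - 2)) * m :=
          Nat.mul_le_mul_right _ (Nat.mul_le_mul_left _ h2)
      _ = _ := by ring

/-! ### Growth of the coefficients -/

theorem coeff_three (k : ℕ) : coeff 3 k = 5 * k + 2 := by
  induction k with
  | zero => rw [coeff_zero]
  | succ k ih => rw [coeff_add_three 0 k, coeff_two_succ, coeff_one_succ, ih]; ring

theorem coeff_four (k : ℕ) : coeff 4 k + 10 * k + 26 = 28 * 2 ^ k := by
  induction k with
  | zero => rw [coeff_zero]; rfl
  | succ k ih => rw [coeff_add_three 1 k, coeff_three, coeff_two_succ, pow_succ]; linarith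

/-- The slack 2 in each exponent gives a factor 1/4, so each of the two summands of the recurrence
is at most half of the target. -/
theorem rpow_two_recurrence {x v w : ℕ → ℕ} {f g h : ℕ → ℝ}
    (hx : ∀ k, 1 ≤ k → x (k + 1) = 2 * v (k + 1) + w (k + 1) * (1 + x k))
    (hv : ∀ k, 1 ≤ k → (v k : ℝ) ≤ 2 ^ g k) (hw : ∀ k, 1 ≤ k → (w k : ℝ) ≤ 2 ^ h k)
    (h1 : (x 1 : ℝ) ≤ 2 ^ f 1) (hf : ∀ k, 1 ≤ k → 0 ≤ f k)
    (hg : ∀ k, 1 ≤ k → g (k + 1) + 2 ≤ f (k + 1))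
    (hh : ∀ k, 1 ≤ k → h (k + 1) + f k + 2 ≤ f (k + 1)) :
    ∀ k, 1 ≤ k → (x k : ℝ) ≤ 2 ^ f k := by
  intro k hk
  induction k, hk using Nat.le_induction with
  | base => exact h1
  | succ k hk ih =>
    have e4 : (2 : ℝ) ^ (2 : ℝ) = 4 := by norm_num
    have a1 : (2 : ℝ) ^ g (k + 1) * 4 ≤ 2 ^ f (k + 1) := by
      rw [← e4, ← Real.rpow_add two_pos]
      exact Real.rpow_le_rpow_of_exponent_le one_le_two (hg k hk)
    have a2 : (2 : ℝ) ^ h (k + 1) * 2 ^ f k * 4 ≤ 2 ^ f (k + 1) := by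
      rw [← e4, ← Real.rpow_add two_pos, ← Real.rpow_add two_pos]
      exact Real.rpow_le_rpow_of_exponent_le one_le_two (hh k hk)
    have a3 : (1 : ℝ) ≤ 2 ^ f k := Real.one_le_rpow one_le_two (hf k hk)
    have a4 : (w (k + 1) : ℝ) * (1 + x k) ≤ 2 ^ h (k + 1) * (2 * 2 ^ f k) :=
      mul_le_mul (hw _ (by omega)) (by linarith) (by positivity) (by positivity)
    have a5 := hv (k + 1) (by omega)
    rw [hx k hk]
    push_cast
    linarith

theorem logb_two_le_self {x : ℝ} (hx : 1 ≤ x) : Real.logb 2 x ≤ x := by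
  rw [Real.logb_le_iff_le_rpow one_lt_two (by linarith)]
  have h := one_add_mul_self_le_rpow_one_add (s := 1) (by norm_num) hx
  norm_num at h
  linarith

/-- Used to put the odd exponent of the order below, x ^ t log x / t!, under x ^ (t + 1) / (t + 1)!
up to O(x ^ t). -/
theorem exists_logb_two_le (a : ℝ) (ha : 0 < a) :
    ∃ c, 0 ≤ c ∧ ∀ x : ℝ, 1 ≤ x → Real.logb 2 x ≤ x / a + c := by
  refine ⟨|Real.logb 2 a|, abs_nonneg _, fun x hx => ?_⟩
  rcases le_total x a with h | h
  · have : Real.logb 2 x ≤ Real.logb 2 a := Real.logb_le_logb_of_le one_lt_two (by linarith) h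
    have h2 : 0 ≤ x / a := by positivity
    linarith [le_abs_self (Real.logb 2 a)]
  · have e : Real.logb 2 x = Real.logb 2 (x / a) + Real.logb 2 a := by
      rw [← Real.logb_mul (by positivity) ha.ne', div_mul_cancel₀ _ ha.ne']
    rw [e]
    exact add_le_add (logb_two_le_self ((one_le_div ha).2 h)) (le_abs_self _)

/-- A crude second-order binomial estimate, multiplied by `x` to avoid the exponent t - 1. -/
theorem mul_pred_pow_le (t : ℕ) {x : ℝ} (hx : 1 ≤ x) :
    x * (x - 1) ^ (t + 1) ≤ x ^ (t + 2) - (t + 1) * x ^ (t + 1) + (t + 1) ^ 2 * x ^ t := by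
  induction t with
  | zero => norm_num; nlinarith
  | succ t ih =>
    have h1 := mul_le_mul_of_nonneg_right ih (by linarith : 0 ≤ x - 1)
    have h2 : 0 ≤ x ^ t := by positivity
    have h3 : 0 ≤ x ^ (t + 1) := by positivity
    have e : x * (x - 1) ^ (t + 1 + 1) = x * (x - 1) ^ (t + 1) * (x - 1) := by ring
    rw [e]
    refine h1.trans ?_
    push_cast
    have e2 : (x ^ (t + 2) - (t + 1) * x ^ (t + 1) + (t + 1) ^ 2 * x ^ t) * (x - 1) =
        x ^ (t + 1 + 2) - (t + 1 + 1) * x ^ (t + 1 + 1) + ((t + 1) ^ 2 + (t + 1)) * x ^ (t + 1)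
          - (t + 1) ^ 2 * x ^ t := by ring
    rw [e2]
    have h4 : (0 : ℝ) ≤ (t + 1) ^ 2 * x ^ t := by positivity
    have h5 : (0 : ℝ) ≤ (t + 2) * x ^ (t + 1) := by positivity
    nlinarith

/-- Makes the error term of the exponent grow by at least its constant times x ^ t, enough to absorb
all lower-order errors. -/
theorem pred_pow_le (t : ℕ) {x : ℝ} (hx : 1 ≤ x) : (x - 1) ^ (t + 1) ≤ x ^ (t + 1) - x ^ t := by
  have : (x - 1) ^ t ≤ x ^ t := pow_le_pow_left₀ (by linarith) (by linarith) t
  rw [pow_succ, pow_succ]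
  nlinarith

/-- The exponent for even orders. -/
noncomputable def evenExp (t : ℕ) (B : ℝ) (k : ℕ) : ℝ :=
  1 / (t.factorial : ℝ) * (k : ℝ) ^ t + B * (k : ℝ) ^ (t - 1)

/-- The exponent for odd orders. -/
noncomputable def oddExp (t : ℕ) (B : ℝ) (k : ℕ) : ℝ :=
  1 / (t.factorial : ℝ) * (k : ℝ) ^ t * Real.logb 2 (k : ℝ) + B * (k : ℝ) ^ t

theorem le_two_rpow_natCast (n : ℕ) : (n : ℝ) ≤ 2 ^ (n : ℝ) := by
  rw [Real.rpow_natCast]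
  exact_mod_cast Nat.lt_two_pow_self.le

theorem coeff_three_le : ∃ B, 0 ≤ B ∧ ∀ k : ℕ, 1 ≤ k → (coeff 3 k : ℝ) ≤ 2 ^ oddExp 0 B k := by
  refine ⟨3, by norm_num, fun k hk => ?_⟩
  have hk' : (1 : ℝ) ≤ k := by exact_mod_cast hk
  rw [oddExp, coeff_three]
  simp only [Nat.factorial_zero, Nat.cast_one, div_one, pow_zero, mul_one, one_mul]
  rw [Real.rpow_add two_pos, Real.rpow_logb two_pos (by norm_num) (by linarith)]
  norm_num
  linarith

theorem coeff_four_le : ∃ B, 0 ≤ B ∧ ∀ k : ℕ, 1 ≤ k → (coeff 4 k : ℝ) ≤ 2 ^ evenExp 1 B k := by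
  refine ⟨5, by norm_num, fun k hk => ?_⟩
  have h : (coeff 4 k : ℝ) ≤ 28 * 2 ^ k := by exact_mod_cast (by have := coeff_four k; omega)
  rw [evenExp]
  simp only [Nat.factorial_one, Nat.cast_one, div_one, pow_one, Nat.sub_self, pow_zero, mul_one,
    one_mul]
  rw [Real.rpow_add two_pos, Real.rpow_natCast]
  have : (0 : ℝ) < 2 ^ k := by positivity
  norm_num
  linarith

theorem coeff_even_step {t : ℕ} (ht : 1 ≤ t) {B₁ B₂ : ℝ} (hB₁ : 0 ≤ B₁) (hB₂ : 0 ≤ B₂)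
    (h₁ : ∀ k : ℕ, 1 ≤ k → (coeff (2 * t + 3) k : ℝ) ≤ 2 ^ oddExp t B₁ k)
    (h₂ : ∀ k : ℕ, 1 ≤ k → (coeff (2 * t + 2) k : ℝ) ≤ 2 ^ evenExp t B₂ k) :
    ∃ B, 0 ≤ B ∧ ∀ k : ℕ, 1 ≤ k → (coeff (2 * t + 4) k : ℝ) ≤ 2 ^ evenExp (t + 1) B k := by
  obtain ⟨c, hc, hlog⟩ := exists_logb_two_le (t + 1) (by positivity)
  obtain ⟨t, rfl⟩ := Nat.exists_eq_add_of_le' ht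
  set D : ℝ := (coeff (2 * (t + 1) + 4) 1 : ℝ)
  have hD0 : 0 ≤ D := by positivity
  -- `D` covers k = 1; c + B₁ + 2 covers the order below; B₂ + 2 + (t + 2) covers the product term.
  set B : ℝ := D + c + B₁ + B₂ + 2 + (t + 2)
  have hB0 : 0 ≤ B := by positivity
  have hfac : (1 : ℝ) ≤ (t + 1).factorial := by
    exact_mod_cast Nat.succ_le_of_lt (Nat.factorial_pos _)
  have hinv : 1 / ((t + 1).factorial : ℝ) ≤ 1 := (div_le_one (by linarith)).2 hfac
  have efac : (t + 2 : ℝ) * (1 / ((t + 1 + 1).factorial : ℝ)) = 1 / ((t + 1).factorial : ℝ) := by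
    rw [Nat.factorial_succ (t + 1)]
    push_cast
    field_simp
    ring
  have efac' : 1 / ((t + 1 + 1).factorial : ℝ) = 1 / ((t + 1).factorial : ℝ) / (t + 1 + 1) := by
    rw [← efac]; field_simp; ring
  refine ⟨B, hB0, rpow_two_recurrence (fun k _ => coeff_add_three (2 * t + 3) k) h₁ h₂ ?_ ?_ ?_ ?_⟩
  · refine (le_two_rpow_natCast _).trans (Real.rpow_le_rpow_of_exponent_le one_le_two ?_)
    rw [evenExp]
    simp only [Nat.cast_one, one_pow, mul_one]
    have : 0 ≤ 1 / ((t + 1 + 1).factorial : ℝ) := by positivity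
    linarith
  · intro k _
    rw [evenExp]
    positivity
  · intro k hk
    have hx : (1 : ℝ) ≤ ((k + 1 : ℕ) : ℝ) := by exact_mod_cast (by omega)
    simp only [evenExp, oddExp]
    generalize ((k + 1 : ℕ) : ℝ) = x at hx ⊢
    set L := Real.logb 2 x
    set I := 1 / ((t + 1).factorial : ℝ)
    have hp : (1 : ℝ) ≤ x ^ (t + 1) := one_le_pow₀ hx
    have hL := hlog x hx
    push_cast at hL
    have k1 : I * x ^ (t + 1) * L ≤ I * x ^ (t + 1) * (x / (t + 1 + 1) + c) :=
      mul_le_mul_of_nonneg_left hL (by positivity)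
    have k2 : I * x ^ (t + 1) * (x / (t + 1 + 1) + c) =
        I / (t + 1 + 1) * x ^ (t + 1 + 1) + I * (c * x ^ (t + 1)) := by ring
    have k3 : I * (c * x ^ (t + 1)) ≤ c * x ^ (t + 1) :=
      mul_le_of_le_one_left (by positivity) hinv
    have k4 : (c + B₁ + 2) * x ^ (t + 1) ≤ B * x ^ (t + 1) :=
      mul_le_mul_of_nonneg_right (by linarith [(Nat.cast_nonneg t : (0 : ℝ) ≤ t)]) (by positivity)
    rw [efac', Nat.add_sub_cancel]
    linarith
  · intro k hk
    have hx : (1 : ℝ) ≤ ((k + 1 : ℕ) : ℝ) := by exact_mod_cast (by omega)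
    have hkx : (k : ℝ) = ((k + 1 : ℕ) : ℝ) - 1 := by push_cast; ring
    simp only [evenExp]
    rw [hkx]
    generalize ((k + 1 : ℕ) : ℝ) = x at hx ⊢
    set I := 1 / ((t + 1).factorial : ℝ)
    set J := 1 / ((t + 1 + 1).factorial : ℝ)
    have hJ : 0 ≤ J := by positivity
    have hp : (1 : ℝ) ≤ x ^ t := one_le_pow₀ hx
    have k1 : (x - 1) ^ (t + 2) ≤ x ^ (t + 2) - (t + 2) * x ^ (t + 1) + (t + 2) ^ 2 * x ^ t := by
      refine le_of_mul_le_mul_left ?_ (by linarith : 0 < x)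
      refine (mul_pred_pow_le (t + 1) hx).trans_eq ?_
      push_cast
      ring
    have k2 := mul_le_mul_of_nonneg_left k1 hJ
    have k3 : J * (x ^ (t + 2) - (t + 2) * x ^ (t + 1) + (t + 2) ^ 2 * x ^ t) =
        J * x ^ (t + 2) - ((t + 2) * J) * x ^ (t + 1) + ((t + 2) * J) * ((t + 2) * x ^ t) := by
      ring
    have k4 : I * ((t + 2) * x ^ t) ≤ (t + 2) * x ^ t :=
      mul_le_of_le_one_left (by positivity) hinv
    have k5 := mul_le_mul_of_nonneg_left (pred_pow_le t hx) hB0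
    have k6 : (B₂ + 2 + (t + 2)) * x ^ t ≤ B * x ^ t :=
      mul_le_mul_of_nonneg_right (by linarith) (by positivity)
    rw [k3, efac] at k2
    simp only [Nat.add_sub_cancel]
    linarith

theorem coeff_odd_step (t : ℕ) {B₁ B₂ : ℝ} (hB₁ : 0 ≤ B₁) (hB₂ : 0 ≤ B₂)
    (h₁ : ∀ k : ℕ, 1 ≤ k → (coeff (2 * t + 4) k : ℝ) ≤ 2 ^ evenExp (t + 1) B₁ k)
    (h₂ : ∀ k : ℕ, 1 ≤ k → (coeff (2 * t + 3) k : ℝ) ≤ 2 ^ oddExp t B₂ k) :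
    ∃ B, 0 ≤ B ∧ ∀ k : ℕ, 1 ≤ k → (coeff (2 * t + 5) k : ℝ) ≤ 2 ^ oddExp (t + 1) B k := by
  set D : ℝ := (coeff (2 * t + 5) 1 : ℝ)
  have hD0 : 0 ≤ D := by positivity
  -- `D` covers k = 1; B₁ + 3 covers the order below, including its leading term; B₂ + 2 + (t + 1)
  -- covers the product term.
  set B : ℝ := D + B₁ + B₂ + 3 + (t + 1)
  have hB0 : 0 ≤ B := by positivity
  have hfac (n : ℕ) : 1 / (n.factorial : ℝ) ≤ 1 :=
    (div_le_one (by positivity)).2 (by exact_mod_cast Nat.succ_le_of_lt (Nat.factorial_pos _))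
  have efac : (t + 1 : ℝ) * (1 / ((t + 1).factorial : ℝ)) = 1 / (t.factorial : ℝ) := by
    rw [Nat.factorial_succ t]
    push_cast
    field_simp
  refine ⟨B, hB0, rpow_two_recurrence (fun k _ => coeff_add_three (2 * t + 2) k) h₁ h₂ ?_ ?_ ?_ ?_⟩
  · refine (le_two_rpow_natCast _).trans (Real.rpow_le_rpow_of_exponent_le one_le_two ?_)
    rw [oddExp]
    simp only [Nat.cast_one, one_pow, mul_one, Real.logb_one, mul_zero, zero_add]
    linarith
  · intro k hk
    have := Real.logb_nonneg one_lt_two (by exact_mod_cast hk : (1 : ℝ) ≤ k)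
    rw [oddExp]
    positivity
  · intro k hk
    have hx : (1 : ℝ) ≤ ((k + 1 : ℕ) : ℝ) := by exact_mod_cast (by omega)
    simp only [evenExp, oddExp]
    generalize ((k + 1 : ℕ) : ℝ) = x at hx ⊢
    have hL := Real.logb_nonneg one_lt_two hx
    have hp : (1 : ℝ) ≤ x ^ t := one_le_pow₀ hx
    have hp' : x ^ t ≤ x ^ (t + 1) := pow_le_pow_right₀ hx (Nat.le_succ t)
    have k1 : 1 / ((t + 1).factorial : ℝ) * x ^ (t + 1) ≤ x ^ (t + 1) :=
      mul_le_of_le_one_left (by positivity) (hfac _)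
    have k2 : 0 ≤ 1 / ((t + 1).factorial : ℝ) * x ^ (t + 1) * Real.logb 2 x := by positivity
    have k3 : (B₁ + 3) * x ^ (t + 1) ≤ B * x ^ (t + 1) :=
      mul_le_mul_of_nonneg_right (by linarith [(Nat.cast_nonneg t : (0 : ℝ) ≤ t)]) (by positivity)
    have k4 := mul_le_mul_of_nonneg_left hp' hB₁
    rw [Nat.add_sub_cancel]
    linarith
  · intro k hk
    have hx : (1 : ℝ) ≤ ((k + 1 : ℕ) : ℝ) := by exact_mod_cast (by omega)
    have hx' : (0 : ℝ) < ((k + 1 : ℕ) : ℝ) - 1 := by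
      push_cast
      have : (0 : ℝ) < k := by exact_mod_cast hk
      linarith
    have hkx : (k : ℝ) = ((k + 1 : ℕ) : ℝ) - 1 := by push_cast; ring
    simp only [oddExp]
    rw [hkx]
    generalize ((k + 1 : ℕ) : ℝ) = x at hx hx' ⊢
    have hL := Real.logb_nonneg one_lt_two hx
    have hLx := logb_two_le_self hx
    have hLL : Real.logb 2 (x - 1) ≤ Real.logb 2 x :=
      Real.logb_le_logb_of_le one_lt_two hx' (by linarith)
    set L := Real.logb 2 x
    set I := 1 / (t.factorial : ℝ)
    set J := 1 / ((t + 1).factorial : ℝ)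
    have hJ : 0 ≤ J := by positivity
    have hp : (1 : ℝ) ≤ x ^ t := one_le_pow₀ hx
    -- The logarithm in the binomial error is bounded by `x`, and the spare factor `x` is then
    -- cancelled.
    have k1 : (x - 1) ^ (t + 1) * L ≤
        x ^ (t + 1) * L - (t + 1) * x ^ t * L + (t + 1) ^ 2 * x ^ t := by
      refine le_of_mul_le_mul_left ?_ (by linarith : 0 < x)
      have h1 := mul_le_mul_of_nonneg_right (mul_pred_pow_le t hx) hL
      have h2 : (t + 1) ^ 2 * x ^ t * L ≤ (t + 1) ^ 2 * x ^ t * x :=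
        mul_le_mul_of_nonneg_left hLx (by positivity)
      linear_combination h1 + h2
    have k2 := mul_le_mul_of_nonneg_left k1 hJ
    have k3 : J * (x ^ (t + 1) * L - (t + 1) * x ^ t * L + (t + 1) ^ 2 * x ^ t) =
        J * x ^ (t + 1) * L - ((t + 1) * J) * (x ^ t * L) +
          ((t + 1) * J) * ((t + 1) * x ^ t) := by
      ring
    have k4 : I * ((t + 1) * x ^ t) ≤ (t + 1) * x ^ t :=
      mul_le_of_le_one_left (by positivity) (hfac _)
    have k5 := mul_le_mul_of_nonneg_left (pred_pow_le t hx) hB0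
    have k6 : (B₂ + 2 + (t + 1)) * x ^ t ≤ B * x ^ t :=
      mul_le_mul_of_nonneg_right (by linarith) (by positivity)
    have k7 : J * (x - 1) ^ (t + 1) * Real.logb 2 (x - 1) ≤ J * ((x - 1) ^ (t + 1) * L) := by
      rw [mul_assoc]
      exact mul_le_mul_of_nonneg_left (mul_le_mul_of_nonneg_left hLL (by positivity)) hJ
    rw [k3, efac] at k2
    linarith

theorem coeff_le (t : ℕ) :
    (∃ B, 0 ≤ B ∧ ∀ k : ℕ, 1 ≤ k → (coeff (2 * t + 3) k : ℝ) ≤ 2 ^ oddExp t B k) ∧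
    (∃ B, 0 ≤ B ∧ ∀ k : ℕ, 1 ≤ k → (coeff (2 * t + 4) k : ℝ) ≤ 2 ^ evenExp (t + 1) B k) := by
  induction t with
  | zero => exact ⟨coeff_three_le, coeff_four_le⟩
  | succ t ih =>
    obtain ⟨⟨B₁, hB₁, h₁⟩, B₂, hB₂, h₂⟩ := ih
    obtain ⟨B₃, hB₃, h₃⟩ := coeff_odd_step t hB₂ hB₁ h₂ h₁
    exact ⟨⟨B₃, hB₃, h₃⟩, coeff_even_step (Nat.le_add_left 1 t) hB₃ hB₂ h₃ h₂⟩

/-! ### Assembling the constants -/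

/-- Constants of the form `2 ^ (f k + B * g k)`, with `g ≥ 1`, absorb a bounded factor. -/
theorem exists_constants {s : ℕ} (hs : 3 ≤ s) (f g : ℕ → ℝ) (hg : ∀ k, 1 ≤ k → 1 ≤ g k)
    (h : ∃ B, 0 ≤ B ∧ ∀ k : ℕ, 1 ≤ k → (coeff s k : ℝ) ≤ 2 ^ (f k + B * g k)) :
    ∃ C : ℕ → ℝ, (∀ k m n : ℕ, 1 ≤ k → 1 ≤ m → 1 ≤ n →
      (psi s m n : ℝ) ≤ C k * ((m : ℝ) * (alphaInv k (m : ℝ) : ℝ) ^ (s - 2) + (n : ℝ))) ∧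
      ∃ B : ℝ, ∀ k : ℕ, 1 ≤ k → 2 ^ (f k - B * g k) ≤ C k ∧ C k ≤ 2 ^ (f k + B * g k) := by
  obtain ⟨c, -, hpsi⟩ := exists_psi_le s hs
  obtain ⟨B, hB, hcoeff⟩ := h
  -- The constant is chosen to be the upper end of the required range, so the lower bound on it only
  -- needs a nonnegative error.
  refine ⟨fun k => 2 ^ (f k + (B + c) * g k), fun k m n hk hm _ => ?_, B + c, fun k hk =>
    ⟨Real.rpow_le_rpow_of_exponent_le one_le_two ?_, le_rfl⟩⟩
  · have h1 : (psi s m n : ℝ) ≤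
        c * coeff s k * ((m : ℝ) * (alphaInv k (m : ℝ) : ℝ) ^ (s - 2) + (n : ℝ)) := by
      exact_mod_cast hpsi k m n hk hm
    refine h1.trans (mul_le_mul_of_nonneg_right ?_ (by positivity))
    have h2 : (c : ℝ) ≤ 2 ^ (c * g k : ℝ) := (le_two_rpow_natCast c).trans
      (Real.rpow_le_rpow_of_exponent_le one_le_two
        (le_mul_of_one_le_right (by positivity) (hg k hk)))
    calc (c : ℝ) * coeff s k ≤ 2 ^ (c * g k : ℝ) * 2 ^ (f k + B * g k) :=
          mul_le_mul h2 (hcoeff k hk) (by positivity) (by positivity)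
      _ = 2 ^ (f k + (B + c) * g k) := by
          rw [← Real.rpow_add two_pos]
          congr 1
          ring
  · have : 0 ≤ (B + c) * g k := mul_nonneg (by positivity) (zero_le_one.trans (hg k hk))
    linarith

end DS

theorem mainTheorem2 :
    (∃ c : ℝ, ∀ k m n : ℕ, 1 ≤ k → 1 ≤ m → 1 ≤ n →
      (DS.psi 3 m n : ℝ) ≤ c * ((k : ℝ) * (m : ℝ) * (DS.alphaInv k (m : ℝ) : ℝ) + (k : ℝ) * (n : ℝ)))
    ∧
    (∀ s t : ℕ, 3 ≤ s → t = (s - 2) / 2 →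
      ∃ C : ℕ → ℝ,
        (∀ k m n : ℕ, 1 ≤ k → 1 ≤ m → 1 ≤ n →
          (DS.psi s m n : ℝ) ≤ C k * ((m : ℝ) * (DS.alphaInv k (m : ℝ) : ℝ) ^ (s - 2) + (n : ℝ))) ∧
        (Even s → ∃ B : ℝ, ∀ k : ℕ, 1 ≤ k →
          (2 : ℝ) ^ ((1 / (t.factorial : ℝ)) * (k : ℝ) ^ t - B * (k : ℝ) ^ (t - 1)) ≤ C k ∧
          C k ≤ (2 : ℝ) ^ ((1 / (t.factorial : ℝ)) * (k : ℝ) ^ t + B * (k : ℝ) ^ (t - 1))) ∧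
        (Odd s → ∃ B : ℝ, ∀ k : ℕ, 1 ≤ k →
          (2 : ℝ) ^ ((1 / (t.factorial : ℝ)) * (k : ℝ) ^ t * Real.logb 2 (k : ℝ)
              - B * (k : ℝ) ^ t) ≤ C k ∧
          C k ≤ (2 : ℝ) ^ ((1 / (t.factorial : ℝ)) * (k : ℝ) ^ t * Real.logb 2 (k : ℝ)
              + B * (k : ℝ) ^ t))) := by
  have one_le (p k : ℕ) (hk : 1 ≤ k) : (1 : ℝ) ≤ (k : ℝ) ^ p :=
    one_le_pow₀ (by exact_mod_cast hk)
  refine ⟨?_, fun s t hs ht => ?_⟩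
  · obtain ⟨c, -, h⟩ := DS.exists_psi_le 3 le_rfl
    refine ⟨7 * c, fun k m n hk hm _ => ?_⟩
    have h1 : DS.psi 3 m n ≤ 7 * c * (k * m * DS.alphaInv k m + k * n) := by
      calc DS.psi 3 m n ≤ c * DS.coeff 3 k * (m * DS.alphaInv k m ^ (3 - 2) + n) := h k m n hk hm
        _ ≤ c * (7 * k) * (m * DS.alphaInv k m ^ (3 - 2) + n) :=
            Nat.mul_le_mul_right _ (Nat.mul_le_mul_left _ (by rw [DS.coeff_three]; omega))
        _ = 7 * c * (k * m * DS.alphaInv k m + k * n) := by ring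
    exact_mod_cast h1
  · rcases Nat.even_or_odd s with he | ho
    · obtain ⟨t', rfl⟩ : ∃ t', s = 2 * t' + 4 := by
        obtain ⟨r, rfl⟩ := he
        exact ⟨r - 2, by omega⟩
      obtain rfl : t = t' + 1 := by omega
      obtain ⟨C, h1, h2⟩ := DS.exists_constants hs
        (fun k => 1 / ((t' + 1).factorial : ℝ) * (k : ℝ) ^ (t' + 1))
        (fun k => (k : ℝ) ^ (t' + 1 - 1)) (one_le _) (DS.coeff_le t').2
      exact ⟨C, h1, fun _ => h2, fun h => absurd he (Nat.not_even_iff_odd.2 h)⟩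
    · obtain ⟨t', rfl⟩ : ∃ t', s = 2 * t' + 3 := by
        obtain ⟨r, rfl⟩ := ho
        exact ⟨r - 1, by omega⟩
      obtain rfl : t = t' := by omega
      obtain ⟨C, h1, h2⟩ := DS.exists_constants hs
        (fun k => 1 / (t.factorial : ℝ) * (k : ℝ) ^ t * Real.logb 2 (k : ℝ))
        (fun k => (k : ℝ) ^ t) (one_le _) (DS.coeff_le t).1
      exact ⟨C, h1, fun h => absurd ho (Nat.not_odd_iff_even.2 h), fun _ => h2⟩
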